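/- Let $n \ge 0$ and let $X_1,\dots,X_n$ be independent $\{0,1\}$-valued random variables, not necessarily identically distributed. Let $f:\{0,1\}^n\to\mathbb R$ and $Z=f(X_1,\dots,X_n)$. Identify $f$ with the set function $F:2^{[n]}\to\mathbb R$ given by $F(A)=f(\mathbf 1_A)$. Assume that at least one of the following holds. (a) $f$ is self-bounding: there are functions $f_i:\{0,1\}^{n-1}\to\mathbb R$ ($1\le i\le n$) such that, writing $x^{(i)}=(x_1,\dots,x_{i-1},x_{i+1},\dots,x_n)$, we have $0\le f(x)-f_i(x^{(i)})\le 1$ for all $x$ and $i$, and $\sum_{i=1}^n\bigl(f(x)-f_i(x^{(i)})\bigr)\le f(x)$ for all $x$. (b) $F$ is non-negative and submodular, that is, $F(A\cup B)+F(A\cap B)\le F(A)+F(B)$ for all $A,B\subseteq[n]$, and all its marginal values $F(A\cup\{j\})-F(A)$ ($A\subseteq[n]$, $j\in[n]$) lie in $[0,1]$ (so $F$ is monotone). (c) $F$ is fractionally subadditive, that is, $F(A)\le\sum_{i=1}^k\beta_iF(B_i)$ for all $k\ge 0$, all $A,B_1,\dots,B_k\subseteq[n]$ and all $\beta_1,\dots,\beta_k\ge0$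 such that $\sum_{i:\,a\in B_i}\beta_i\ge1$ for every $a\in A$, and all its marginal values lie in $[0,1]$. Then for every real $\delta>0$, $$\Pr\bigl[Z\ge(1+\delta)\,\mathbf E[Z]\bigr]\le\left(\frac{e^\delta}{(1+\delta)^{1+\delta}}\right)^{\mathbf E[Z]}$$ and $$\Pr\bigl[Z\le(1-\delta)\,\mathbf E[Z]\bigr]\le e^{-\delta^2\,\mathbf E[Z]/2}.$$ -/

import Mathlib

open MeasureTheory ProbabilityTheory

/-- A function `f : {0,1}ⁿ → ℝ` is self-bounding if there are functions `g i` of the point `x` with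
its `i`-th coordinate deleted such that `0 ≤ f x - g i x⁽ⁱ⁾ ≤ 1` for all `x`, `i`, and
`∑ i, (f x - g i x⁽ⁱ⁾) ≤ f x` for all `x`. -/
def IsSelfBounding {n : ℕ} (f : (Fin n → Bool) → ℝ) : Prop :=
  ∃ g : (i : Fin n) → ({j : Fin n // j ≠ i} → Bool) → ℝ,
    (∀ (x : Fin n → Bool) (i : Fin n),
      0 ≤ f x - g i (fun j => x j.1) ∧ f x - g i (fun j => x j.1) ≤ 1) ∧
    (∀ x : Fin n → Bool, ∑ i, (f x - g i (fun j => x j.1)) ≤ f x)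

/-- The set function on subsets of `N = [n]` identified with a function on `{0,1}ⁿ`: its value
at `A` is the value of `f` at the indicator vector of `A`. -/
def toSetFunction {n : ℕ} (f : (Fin n → Bool) → ℝ) : Finset (Fin n) → ℝ :=
  fun A => f (fun i => decide (i ∈ A))

/-- Submodular set functions. -/
def IsSubmodular {n : ℕ} (F : Finset (Fin n) → ℝ) : Prop :=
  ∀ A B : Finset (Fin n), F (A ∪ B) + F (A ∩ B) ≤ F A + F B

/-- Fractionally subadditive set functions: `F A ≤ ∑ i, β i * F (B i)` for every finite family of
sets `B i` with weights `β i ≥ 0` that fractionally covers `A`. -/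
def IsFractionallySubadditive {n : ℕ} (F : Finset (Fin n) → ℝ) : Prop :=
  ∀ (A : Finset (Fin n)) (k : ℕ) (B : Fin k → Finset (Fin n)) (β : Fin k → ℝ),
    (∀ i, 0 ≤ β i) →
    (∀ a ∈ A, 1 ≤ ∑ i ∈ Finset.univ.filter (fun i => a ∈ B i), β i) →
    F A ≤ ∑ i, β i * F (B i)

/-- The marginal value of `j` with respect to `A`. -/
def marginalValue {n : ℕ} (F : Finset (Fin n) → ℝ) (A : Finset (Fin n)) (j : Fin n) : ℝ :=
  F (A ∪ {j}) - F A

/-!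
The proof is the entropy method for self-bounding functions.

Both set-function hypotheses imply self-boundedness with `fᵢ(x⁽ⁱ⁾) = f(x with xᵢ = 0)`: the required
inequality `∑_{i ∈ A} (F A - F (A \ {i})) ≤ F A` follows from submodularity by removing the elements
one after another, and from fractional subadditivity by covering `A` with the sets `A \ {i}`, each
of weight `1 / (|A| - 1)`.

For self-bounding `f`, let `M λ = E[exp (λ Z)]`. Tensorization of entropy
(`entropy_le_weightedMean_sum_logDivergence`) bounds the entropy `λ M' λ - M λ log (M λ)` of
`exp (λ Z)` by `∑ i, E[exp (λ f) φ(-λ (f - fᵢ))]` with `φ t = exp t - t - 1`. As `φ` is convex with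
`φ 0 = 0` and `f - fᵢ ∈ [0, 1]` has sum at most `f`, this is at most `φ(-λ) M' λ`, so that
`(1 - exp (-λ)) M' λ ≤ M λ log (M λ)`. Equivalently `log (M λ) / (exp λ - 1)` decreases on either
side of `0`; its limit at `0` is `E[Z]`, which gives the Poisson bound
`M λ ≤ exp ((exp λ - 1) E[Z])` for all real `λ`. The tail bounds are Chernoff's inequality for
`λ = log (1 + δ)` and `λ = -δ`.
-/

/-! ### Entropy on finite product spaces -/

/-- The integrand `u log (u / c) - u + c` of the generalized relative entropy of two positive
functions. -/
noncomputable def logDivergence (u c : ℝ) : ℝ :=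
  u * Real.log u - u * Real.log c - u + c

theorem logDivergence_nonneg {u c : ℝ} (hu : 0 < u) (hc : 0 < c) : 0 ≤ logDivergence u c := by
  have h := Real.log_le_sub_one_of_pos (div_pos hc hu)
  rw [Real.log_div hc.ne' hu.ne'] at h
  have h2 := mul_le_mul_of_nonneg_left h hu.le
  have h3 : u * (c / u - 1) = c - u := by field_simp
  unfold logDivergence
  linarith

/-- The tangent plane inequality for the jointly convex function `logDivergence`. -/
theorem logDivergence_tangent {u c U C : ℝ} (hu : 0 < u) (hc : 0 < c) (hU : 0 < U) (hC : 0 < C) :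
    u * (Real.log U - Real.log C) - c * (U / C) + c ≤ logDivergence u c := by
  have h := logDivergence_nonneg hu (mul_pos hc (div_pos hU hC))
  unfold logDivergence at *
  rw [Real.log_mul hc.ne' (div_pos hU hC).ne', Real.log_div hU.ne' hC.ne'] at h
  linarith

/-- The log-sum inequality, in the form of Jensen's inequality for `logDivergence`. -/
theorem logDivergence_sum_le {ι : Type*} [Fintype ι] (w u c : ι → ℝ) (hw : ∀ x, 0 ≤ w x)
    (hu : ∀ x, 0 < u x) (hc : ∀ x, 0 < c x) (hU : 0 < ∑ x, w x * u x) (hC : 0 < ∑ x, w x * c x) :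
    logDivergence (∑ x, w x * u x) (∑ x, w x * c x) ≤ ∑ x, w x * logDivergence (u x) (c x) := by
  set U := ∑ x, w x * u x with hUdef
  set C := ∑ x, w x * c x with hCdef
  calc logDivergence U C = U * (Real.log U - Real.log C) - C * (U / C) + C := by
        unfold logDivergence
        field_simp
    _ = ∑ x, w x * (u x * (Real.log U - Real.log C) - c x * (U / C) + c x) := by
        simp only [mul_add, mul_sub, Finset.sum_add_distrib, Finset.sum_sub_distrib, ← mul_assoc,
          ← Finset.sum_mul, ← hUdef, ← hCdef]
    _ ≤ _ := Finset.sum_le_sum fun x _ =>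
        mul_le_mul_of_nonneg_left (logDivergence_tangent (hu x) (hc x) hU hC) (hw x)

/-- The mean of `h` under the product of the weights `p i`, which are the point masses of the
factors. -/
noncomputable def weightedMean {α : Type*} [Fintype α] {n : ℕ} (p : Fin n → α → ℝ)
    (h : (Fin n → α) → ℝ) : ℝ :=
  ∑ x, (∏ i, p i (x i)) * h x

section weightedMean

variable {α : Type*} [Fintype α] {n : ℕ}

theorem weightedMean_add (p : Fin n → α → ℝ) (h k : (Fin n → α) → ℝ) :
    weightedMean p (fun x => h x + k x) = weightedMean p h + weightedMean p k := by
  simp only [weightedMean, mul_add, Finset.sum_add_distrib]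

theorem weightedMean_const_mul (p : Fin n → α → ℝ) (h : (Fin n → α) → ℝ) (a : ℝ) :
    weightedMean p (fun x => a * h x) = a * weightedMean p h := by
  simp only [weightedMean, Finset.mul_sum]
  exact Finset.sum_congr rfl fun x _ => by ring

theorem weightedMean_mono {p : Fin n → α → ℝ} (hp : ∀ i a, 0 ≤ p i a) {h k : (Fin n → α) → ℝ}
    (hk : ∀ x, h x ≤ k x) : weightedMean p h ≤ weightedMean p k :=
  Finset.sum_le_sum fun x _ =>
    mul_le_mul_of_nonneg_left (hk x) (Finset.prod_nonneg fun i _ => hp i _)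

theorem sum_prod_weights {p : Fin n → α → ℝ} (hp1 : ∀ i, ∑ a, p i a = 1) :
    ∑ x : Fin n → α, ∏ i, p i (x i) = 1 := by
  classical
  rw [← Fintype.prod_sum]
  simp [hp1]

theorem weightedMean_pos {p : Fin n → α → ℝ} (hp : ∀ i a, 0 ≤ p i a)
    (hp1 : ∀ i, ∑ a, p i a = 1) {h : (Fin n → α) → ℝ} (hh : ∀ x, 0 < h x) :
    0 < weightedMean p h := by
  have hw : ∀ x : Fin n → α, 0 ≤ ∏ i, p i (x i) := fun x => Finset.prod_nonneg fun i _ => hp i _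
  obtain ⟨x, -, hx⟩ : ∃ x ∈ Finset.univ, (0 : ℝ) < ∏ i, p i ((x : Fin n → α) i) :=
    Finset.exists_lt_of_sum_lt (by rw [sum_prod_weights hp1]; simp)
  exact Finset.sum_pos' (fun y _ => mul_nonneg (hw y) (hh y).le)
    ⟨x, Finset.mem_univ _, mul_pos hx (hh x)⟩

theorem weightedMean_succ (p : Fin (n + 1) → α → ℝ) (h : (Fin (n + 1) → α) → ℝ) :
    weightedMean p h =
      ∑ a, p 0 a * weightedMean (fun i => p i.succ) (fun y => h (Fin.cons a y)) := by
  unfold weightedMean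
  rw [← (Fin.consEquiv fun _ => α).sum_comp, Fintype.sum_prod_type]
  refine Finset.sum_congr rfl fun a _ => ?_
  rw [Finset.mul_sum]
  refine Finset.sum_congr rfl fun y _ => ?_
  simp [Fin.consEquiv, Fin.prod_univ_succ, mul_assoc]

end weightedMean

/-- Tensorization of entropy, combined with the variational bound
`Ent(u) ≤ E[u log u - u log c - u + c]` in each coordinate: `c i` is any positive function
that does not depend on the `i`-th coordinate. -/
theorem entropy_le_weightedMean_sum_logDivergence {α : Type*} [Fintype α] {n : ℕ}
    (p : Fin n → α → ℝ) (hp : ∀ i a, 0 ≤ p i a) (hp1 : ∀ i, ∑ a, p i a = 1)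
    (u : (Fin n → α) → ℝ) (hu : ∀ x, 0 < u x)
    (c : Fin n → (Fin n → α) → ℝ) (hc : ∀ i x, 0 < c i x)
    (hci : ∀ i x y, (∀ j, j ≠ i → x j = y j) → c i x = c i y) :
    weightedMean p (fun x => u x * Real.log (u x))
        - weightedMean p u * Real.log (weightedMean p u) ≤
      weightedMean p (fun x => ∑ i, logDivergence (u x) (c i x)) := by
  induction n with
  | zero => simp [weightedMean]
  | succ n ih =>
    obtain ⟨a₀⟩ : Nonempty α := by
      by_contra hne
      rw [not_nonempty_iff] at hne
      simpa using hp1 0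
    set q : Fin n → α → ℝ := fun i => p i.succ
    have hq : ∀ i a, 0 ≤ q i a := fun i a => hp _ a
    have hq1 : ∀ i, ∑ a, q i a = 1 := fun i => hp1 _
    set U : α → ℝ := fun a => weightedMean q (fun y => u (Fin.cons a y))
    set C : ℝ := weightedMean q (fun y => c 0 (Fin.cons a₀ y)) with hCdef
    have hU : ∀ a, 0 < U a := fun a => weightedMean_pos hq hq1 fun y => hu _
    have hC : 0 < C := weightedMean_pos hq hq1 fun y => hc _ _
    have hW : weightedMean p u = ∑ a, p 0 a * U a := weightedMean_succ p u
    have hWpos : 0 < weightedMean p u := weightedMean_pos hp hp1 hu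
    -- The last `n` coordinates, for a fixed value `a` of the first one.
    have htail : ∀ a, weightedMean q (fun y => u (Fin.cons a y) * Real.log (u (Fin.cons a y)))
        - U a * Real.log (U a) ≤
        weightedMean q
          (fun y => ∑ i : Fin n, logDivergence (u (Fin.cons a y)) (c i.succ (Fin.cons a y))) := by
      intro a
      refine ih q hq hq1 (fun y => u (Fin.cons a y)) (fun y => hu _)
        (fun i y => c i.succ (Fin.cons a y)) (fun i y => hc _ _) fun i x y hxy => hci _ _ _ ?_
      intro j hj
      refine Fin.cases (fun _ => by simp) (fun k hk => ?_) j hj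
      simpa using hxy k fun h => hk (h ▸ rfl)
    -- The first coordinate: averaging over the others contracts the divergence.
    have hhead : ∀ a, logDivergence (U a) C ≤
        weightedMean q (fun y => logDivergence (u (Fin.cons a y)) (c 0 (Fin.cons a y))) := by
      intro a
      have hCa : C = weightedMean q (fun y => c 0 (Fin.cons a y)) := by
        rw [hCdef]
        congr 1
        funext y
        refine hci 0 _ _ fun j hj => ?_
        obtain ⟨k, rfl⟩ := Fin.exists_succ_eq.2 hj
        simp
      rw [hCa]
      exact logDivergence_sum_le _ _ _ (fun x => Finset.prod_nonneg fun i _ => hq i _)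
        (fun _ => hu _) (fun _ => hc _ _) (hU a)
        (weightedMean_pos hq hq1 fun _ => hc _ _)
    have hsum : ∑ a, p 0 a * (weightedMean q
          (fun y => u (Fin.cons a y) * Real.log (u (Fin.cons a y))) - U a * Real.log (U a)
            + logDivergence (U a) C) ≤
        weightedMean p (fun x => ∑ i, logDivergence (u x) (c i x)) := by
      rw [weightedMean_succ]
      refine Finset.sum_le_sum fun a _ => mul_le_mul_of_nonneg_left ?_ (hp 0 a)
      simp only [Fin.sum_univ_succ]
      rw [weightedMean_add]
      linarith [htail a, hhead a]
    have hexp : ∑ a, p 0 a * (weightedMean q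
          (fun y => u (Fin.cons a y) * Real.log (u (Fin.cons a y))) - U a * Real.log (U a)
            + logDivergence (U a) C) =
        weightedMean p (fun x => u x * Real.log (u x))
          - weightedMean p u * Real.log C - weightedMean p u + C := by
      rw [hW, weightedMean_succ p (fun x => u x * Real.log (u x)), Finset.sum_mul]
      have h1 : ∑ a, p 0 a * C = C := by rw [← Finset.sum_mul, hp1, one_mul]
      calc _ = ∑ a, (p 0 a * weightedMean q
                (fun y => u (Fin.cons a y) * Real.log (u (Fin.cons a y)))
              - p 0 a * U a * Real.log C - p 0 a * U a + p 0 a * C) := by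
            refine Finset.sum_congr rfl fun a _ => ?_
            unfold logDivergence
            ring
        _ = _ := by
            rw [Finset.sum_add_distrib, Finset.sum_sub_distrib, Finset.sum_sub_distrib, h1]
    have hD := logDivergence_nonneg hWpos hC
    unfold logDivergence at hD
    linarith

/-! ### Moment generating functions of self-bounding functions -/

theorem exp_neg_mul_le (t : ℝ) {u : ℝ} (hu0 : 0 ≤ u) (hu1 : u ≤ 1) :
    Real.exp (-(t * u)) ≤ 1 - u + u * Real.exp (-t) := by
  have h := convexOn_exp.2 (Set.mem_univ 0) (Set.mem_univ (-t)) (sub_nonneg.2 hu1) hu0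
    (by ring)
  simp only [smul_eq_mul, mul_zero, zero_add, Real.exp_zero, mul_one] at h
  rwa [show u * -t = -(t * u) by ring] at h

theorem hasDerivAt_weightedMean_exp {n : ℕ} (p : Fin n → Bool → ℝ) (f : (Fin n → Bool) → ℝ)
    (t : ℝ) :
    HasDerivAt (fun t => weightedMean p (fun x => Real.exp (t * f x)))
      (weightedMean p (fun x => f x * Real.exp (t * f x))) t := by
  unfold weightedMean
  refine HasDerivAt.fun_sum fun x _ => HasDerivAt.const_mul _ ?_
  have h := ((hasDerivAt_id t).mul_const (f x)).exp
  simpa [mul_comm] using h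

/-- The differential inequality `(1 - exp (-t)) M' ≤ M log M` for the moment generating function
`M` of a self-bounding function. -/
theorem IsSelfBounding.mgf_differential_inequality {n : ℕ} {f : (Fin n → Bool) → ℝ}
    (hf : IsSelfBounding f) {p : Fin n → Bool → ℝ} (hp : ∀ i a, 0 ≤ p i a)
    (hp1 : ∀ i, ∑ a, p i a = 1) (t : ℝ) :
    (1 - Real.exp (-t)) * weightedMean p (fun x => f x * Real.exp (t * f x)) ≤
      weightedMean p (fun x => Real.exp (t * f x))
        * Real.log (weightedMean p (fun x => Real.exp (t * f x))) := by
  obtain ⟨g, hg, hsum⟩ := hf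
  have hent := entropy_le_weightedMean_sum_logDivergence p hp hp1 (fun x => Real.exp (t * f x))
    (fun x => Real.exp_pos _) (fun i x => Real.exp (t * g i (fun j => x j.1)))
    (fun i x => Real.exp_pos _) (fun i x y hxy => by
      have : (fun j : {j : Fin n // j ≠ i} => x j.1) = fun j => y j.1 :=
        funext fun j => hxy j.1 j.2
      simp only [this])
  have hφ : 0 ≤ t - 1 + Real.exp (-t) := by linarith [Real.add_one_le_exp (-t)]
  have hpt : ∀ x, ∑ i, logDivergence (Real.exp (t * f x))
      (Real.exp (t * g i (fun j => x j.1))) ≤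
      (t - 1 + Real.exp (-t)) * (f x * Real.exp (t * f x)) := by
    intro x
    calc _ ≤ ∑ i, (t - 1 + Real.exp (-t)) * Real.exp (t * f x)
            * (f x - g i (fun j => x j.1)) := by
          refine Finset.sum_le_sum fun i _ => ?_
          have h := mul_le_mul_of_nonneg_left (exp_neg_mul_le t (hg x i).1 (hg x i).2)
            (Real.exp_pos (t * f x)).le
          rw [← Real.exp_add, show t * f x + -(t * (f x - g i (fun j => x j.1)))
            = t * g i (fun j => x j.1) by ring] at h
          unfold logDivergence
          rw [Real.log_exp, Real.log_exp]
          linarith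
      _ = (t - 1 + Real.exp (-t)) * Real.exp (t * f x) * ∑ i, (f x - g i (fun j => x j.1)) := by
          rw [Finset.mul_sum]
      _ ≤ (t - 1 + Real.exp (-t)) * Real.exp (t * f x) * f x :=
          mul_le_mul_of_nonneg_left (hsum x) (mul_nonneg hφ (Real.exp_pos _).le)
      _ = _ := by ring
  have hle := weightedMean_mono hp hpt
  rw [weightedMean_const_mul] at hle
  have hlog : weightedMean p (fun x => Real.exp (t * f x) * Real.log (Real.exp (t * f x))) =
      t * weightedMean p (fun x => f x * Real.exp (t * f x)) := by
    rw [← weightedMean_const_mul]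
    congr 1
    funext x
    rw [Real.log_exp]
    ring
  rw [hlog] at hent
  linarith

/-- If `(1 - exp (-t)) G' ≤ G` and `G 0 = 0`, then `G t ≤ (exp t - 1) G' 0` on both sides of `0`,
because `G t / (exp t - 1)` is decreasing on either side, with limit `G' 0` at `0`. -/
theorem le_exp_sub_one_mul_of_deriv_le {G G' : ℝ → ℝ} (hG : ∀ t, HasDerivAt G (G' t) t)
    (hG0 : G 0 = 0) (hle : ∀ t, (1 - Real.exp (-t)) * G' t ≤ G t) (t : ℝ) :
    G t ≤ (Real.exp t - 1) * G' 0 := by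
  have hne : ∀ s : ℝ, s ≠ 0 → Real.exp s - 1 ≠ 0 := fun s hs h =>
    hs (by rw [← Real.exp_eq_one_iff]; linarith)
  have hR : ∀ s, s ≠ 0 → HasDerivAt (fun s => G s / (Real.exp s - 1))
      ((G' s * (Real.exp s - 1) - G s * Real.exp s) / (Real.exp s - 1) ^ 2) s := fun s hs =>
    (hG s).fun_div ((Real.hasDerivAt_exp s).sub_const 1) (hne s hs)
  have hR' : ∀ s, (G' s * (Real.exp s - 1) - G s * Real.exp s) / (Real.exp s - 1) ^ 2 ≤ 0 := by
    intro s
    refine div_nonpos_of_nonpos_of_nonneg ?_ (sq_nonneg _)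
    have h := mul_le_mul_of_nonneg_left (hle s) (Real.exp_pos s).le
    have h2 : Real.exp s * ((1 - Real.exp (-s)) * G' s) = G' s * (Real.exp s - 1) := by
      rw [Real.exp_neg]
      field_simp
    linarith
  have hanti : ∀ S : Set ℝ, Convex ℝ S → IsOpen S → (0 : ℝ) ∉ S →
      AntitoneOn (fun s => G s / (Real.exp s - 1)) S := by
    intro S hS hSo h0
    have hn : ∀ s ∈ S, s ≠ 0 := fun s hs h => h0 (h ▸ hs)
    refine antitoneOn_of_hasDerivWithinAt_nonpos hS
      (fun s hs => (hR s (hn s hs)).continuousAt.continuousWithinAt)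
      (fun s hs => (hR s (hn s (interior_subset hs))).hasDerivWithinAt) fun s _ => hR' s
  have hlim : Filter.Tendsto (fun s => G s / (Real.exp s - 1)) (nhdsWithin 0 {0}ᶜ)
      (nhds (G' 0)) := by
    have h1 := (hasDerivAt_iff_tendsto_slope.1 (hG 0))
    have h2 := (hasDerivAt_iff_tendsto_slope.1 (Real.hasDerivAt_exp 0))
    have h3 := h1.div h2 (Real.exp_pos 0).ne'
    rw [Real.exp_zero, div_one] at h3
    refine h3.congr' ?_
    filter_upwards [self_mem_nhdsWithin] with s hs
    have hs0 : s ≠ 0 := hs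
    simp only [Pi.div_apply, slope_def_field, hG0, Real.exp_zero, sub_zero]
    rw [div_div_div_cancel_right₀ hs0]
  rcases lt_trichotomy t 0 with ht | rfl | ht
  · have hl := hlim.mono_left (nhdsLT_le_nhdsNE 0)
    have h : G' 0 ≤ G t / (Real.exp t - 1) := by
      refine le_of_tendsto hl ?_
      filter_upwards [Ioo_mem_nhdsLT ht] with s hs
      exact hanti _ (convex_Iio 0) isOpen_Iio (by simp) ht hs.2 hs.1.le
    have hneg : Real.exp t - 1 < 0 := by linarith [Real.exp_lt_one_iff.2 ht]
    rw [le_div_iff_of_neg hneg] at h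
    linarith
  · simp [hG0]
  · have hl := hlim.mono_left (nhdsGT_le_nhdsNE 0)
    have h : G t / (Real.exp t - 1) ≤ G' 0 := by
      refine ge_of_tendsto hl ?_
      filter_upwards [Ioo_mem_nhdsGT ht] with s hs
      exact hanti _ (convex_Ioi 0) isOpen_Ioi (by simp) hs.1 ht hs.2.le
    have hpos : 0 < Real.exp t - 1 := by linarith [Real.one_lt_exp_iff.2 ht]
    rw [div_le_iff₀ hpos] at h
    linarith

/-- The moment generating function of a self-bounding function is dominated by that of a Poisson
variable with the same mean. -/
theorem IsSelfBounding.weightedMean_exp_le {n : ℕ} {f : (Fin n → Bool) → ℝ}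
    (hf : IsSelfBounding f) {p : Fin n → Bool → ℝ} (hp : ∀ i a, 0 ≤ p i a)
    (hp1 : ∀ i, ∑ a, p i a = 1) (t : ℝ) :
    weightedMean p (fun x => Real.exp (t * f x)) ≤
      Real.exp ((Real.exp t - 1) * weightedMean p f) := by
  have hpos : ∀ s : ℝ, 0 < weightedMean p (fun x => Real.exp (s * f x)) := fun s =>
    weightedMean_pos hp hp1 fun x => Real.exp_pos _
  have h1 : weightedMean p (fun _ => 1) = 1 := by
    simpa [weightedMean] using sum_prod_weights hp1
  have h := le_exp_sub_one_mul_of_deriv_le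
    (fun s => (hasDerivAt_weightedMean_exp p f s).log (hpos s).ne') (by simp [h1])
    (fun s => by
      rw [← mul_div_assoc, div_le_iff₀ (hpos s), mul_comm (Real.log _)]
      exact hf.mgf_differential_inequality hp hp1 s) t
  simp only [zero_mul, Real.exp_zero, mul_one, h1, div_one] at h
  exact (Real.log_le_iff_le_exp (hpos t)).1 h

/-! ### Set functions with marginal values in the unit interval -/

theorem IsSubmodular.sum_sub_erase_le {n : ℕ} {F : Finset (Fin n) → ℝ} (hF : IsSubmodular F)
    (hF0 : ∀ A, 0 ≤ F A) (A : Finset (Fin n)) : ∑ i ∈ A, (F A - F (A.erase i)) ≤ F A := by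
  have key : ∀ S ⊆ A, ∑ i ∈ S, (F A - F (A.erase i)) ≤ F A - F (A \ S) := by
    intro S
    induction S using Finset.induction_on with
    | empty => simp
    | insert i S hi ih =>
      intro hS
      rw [Finset.insert_subset_iff] at hS
      rw [Finset.sum_insert hi]
      have h := hF (A \ S) (A.erase i)
      have h1 : A \ S ∪ A.erase i = A := by
        ext j
        by_cases hj : j = i <;> simp_all
      have h2 : A \ S ∩ A.erase i = A \ insert i S := by
        ext j
        simp only [Finset.mem_inter, Finset.mem_sdiff, Finset.mem_erase, Finset.mem_insert]
        tauto
      rw [h1, h2] at h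
      linarith [ih hS.2]
  linarith [key A subset_rfl, hF0 (A \ A)]

theorem IsFractionallySubadditive.sum_sub_erase_le {n : ℕ} {F : Finset (Fin n) → ℝ}
    (hF : IsFractionallySubadditive F) (A : Finset (Fin n)) :
    ∑ i ∈ A, (F A - F (A.erase i)) ≤ F A := by
  -- Covering `∅` by `∅` with weight `2`.
  have hempty : 0 ≤ F ∅ := by
    have h := hF ∅ 1 (fun _ => ∅) (fun _ => 2) (by simp) (by simp)
    simp at h
    linarith
  rcases lt_or_ge A.card 2 with hA | hA
  · interval_cases hc : A.card
    · rw [Finset.card_eq_zero] at hc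
      simpa [hc] using hempty
    · obtain ⟨i, rfl⟩ := Finset.card_eq_one.1 hc
      simpa using hempty
  · have hpos : (0 : ℝ) < A.card - 1 := by
      have : (2 : ℝ) ≤ A.card := by exact_mod_cast hA
      linarith
    -- Indices outside `A` get weight `0`, so that the cover is indexed by all of `Fin n`.
    have h := hF A n (fun i => A.erase i) (fun i => if i ∈ A then ((A.card : ℝ) - 1)⁻¹ else 0)
      (fun i => by split_ifs <;> simp [hpos.le]) (fun a ha => by
        have hfilter : (Finset.univ.filter fun i => a ∈ A.erase i).filter (· ∈ A)
            = A.erase a := by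
          ext i
          simp only [Finset.mem_filter, Finset.mem_univ, true_and, Finset.mem_erase]
          tauto
        rw [← Finset.sum_filter, hfilter, Finset.sum_const, Finset.card_erase_of_mem ha,
          nsmul_eq_mul, Nat.cast_sub (by omega), Nat.cast_one, mul_inv_cancel₀ hpos.ne'])
    simp only [ite_mul, zero_mul] at h
    rw [← Finset.sum_filter, Finset.filter_univ_mem, ← Finset.mul_sum, inv_mul_eq_div,
      le_div_iff₀ hpos] at h
    rw [Finset.sum_sub_distrib, Finset.sum_const, nsmul_eq_mul]
    linarith

/-- A function on the cube is self-bounding, with `fᵢ(x⁽ⁱ⁾) = f(x with xᵢ = 0)`, if the marginal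
values of its set function lie in `[0, 1]` and the losses of `A` on removing single elements add up
to at most the value of `A`. -/
theorem isSelfBounding_of_sum_sub_erase_le {n : ℕ} {f : (Fin n → Bool) → ℝ}
    (hm : ∀ A j, marginalValue (toSetFunction f) A j ∈ Set.Icc (0 : ℝ) 1)
    (hsum : ∀ A : Finset (Fin n),
      ∑ i ∈ A, (toSetFunction f A - toSetFunction f (A.erase i)) ≤ toSetFunction f A) :
    IsSelfBounding f := by
  let S : (Fin n → Bool) → Finset (Fin n) := fun x => Finset.univ.filter fun i => x i = true
  have hfS : ∀ x, f x = toSetFunction f (S x) := fun x => by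
    unfold toSetFunction
    congr 1
    funext i
    simp [S]
  have hgS : ∀ x i, f (fun j => if h : j ≠ i then x j else false)
      = toSetFunction f ((S x).erase i) := fun x i => by
    unfold toSetFunction
    congr 1
    funext j
    by_cases h : j = i <;> simp [S, h]
  refine ⟨fun i y => f fun j => if h : j ≠ i then y ⟨j, h⟩ else false, fun x i => ?_, fun x => ?_⟩
  · simp only [hgS]
    rw [hfS x]
    by_cases hi : i ∈ S x
    · have h := hm ((S x).erase i) i
      rw [marginalValue, Finset.union_comm, ← Finset.insert_eq, Finset.insert_erase hi] at h
      exact h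
    · rw [Finset.erase_eq_of_notMem hi]
      simp
  · simp only [hgS]
    rw [hfS x]
    refine le_trans (le_of_eq ?_) (hsum (S x))
    refine (Finset.sum_subset (Finset.subset_univ _) fun i _ hi => ?_).symm
    rw [Finset.erase_eq_of_notMem hi, sub_self]

theorem IsSelfBounding.nonneg {n : ℕ} {f : (Fin n → Bool) → ℝ} (hf : IsSelfBounding f)
    (x : Fin n → Bool) : 0 ≤ f x := by
  obtain ⟨g, hg, hsum⟩ := hf
  exact (Finset.sum_nonneg fun i _ => (hg x i).1).trans (hsum x)

/-! ### Tail bounds -/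

theorem integral_comp_eq_weightedMean {n : ℕ} {Ω : Type*} [MeasurableSpace Ω] (μ : Measure Ω)
    [IsProbabilityMeasure μ] {X : Fin n → Ω → Bool} (hX : ∀ i, Measurable (X i))
    (hindep : iIndepFun X μ) (h : (Fin n → Bool) → ℝ) :
    ∫ ω, h (fun i => X i ω) ∂μ = weightedMean (fun i a => (μ.map (X i)).real {a}) h := by
  have hpr : ∀ i, IsProbabilityMeasure (μ.map (X i)) := fun i =>
    Measure.isProbabilityMeasure_map (hX i).aemeasurable
  have hmap := (iIndepFun_iff_map_fun_eq_pi_map fun i => (hX i).aemeasurable).1 hindep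
  rw [← integral_map (φ := fun ω i => X i ω) (measurable_pi_lambda _ hX).aemeasurable
    (measurable_of_finite h).aestronglyMeasurable, hmap, integral_fintype .of_finite]
  unfold weightedMean
  refine Finset.sum_congr rfl fun x _ => ?_
  simp [Measure.real, Measure.pi_singleton, ENNReal.toReal_prod]

theorem exp_neg_le_quadratic {s : ℝ} (hs : 0 ≤ s) : Real.exp (-s) ≤ 1 - s + s ^ 2 / 2 := by
  have hd : ∀ t : ℝ, HasDerivAt (fun t => 1 - t + t ^ 2 / 2 - Real.exp (-t))
      (t - 1 + Real.exp (-t)) t := fun t => by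
    have h := (((hasDerivAt_id t).const_sub 1).add ((hasDerivAt_pow 2 t).div_const 2)).sub
      ((hasDerivAt_id t).neg.exp)
    refine h.congr_deriv ?_
    simp
    ring
  have hmono := monotone_of_hasDerivAt_nonneg hd fun t => by
    change 0 ≤ t - 1 + Real.exp (-t)
    linarith [Real.add_one_le_exp (-t)]
  have h := hmono hs
  simp at h
  linarith

theorem corollary3p2 {n : ℕ} {Ω : Type*} [MeasurableSpace Ω] (μ : Measure Ω)
    [IsProbabilityMeasure μ] (X : Fin n → Ω → Bool) (hX : ∀ i, Measurable (X i))
    (hindep : iIndepFun X μ) (f : (Fin n → Bool) → ℝ)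
    (hf : IsSelfBounding f ∨
      (((∀ A, 0 ≤ toSetFunction f A) ∧ IsSubmodular (toSetFunction f)) ∨
          IsFractionallySubadditive (toSetFunction f)) ∧
        ∀ A j, marginalValue (toSetFunction f) A j ∈ Set.Icc (0 : ℝ) 1)
    (Z : Ω → ℝ) (hZ : ∀ ω, Z ω = f (fun i => X i ω))
    (δ : ℝ) (hδ : 0 < δ) :
    μ.real {ω | (1 + δ) * (∫ ω', Z ω' ∂μ) ≤ Z ω} ≤
        (Real.exp δ / (1 + δ) ^ (1 + δ)) ^ (∫ ω, Z ω ∂μ) ∧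
      μ.real {ω | Z ω ≤ (1 - δ) * (∫ ω', Z ω' ∂μ)} ≤
        Real.exp (-(δ ^ 2 * (∫ ω, Z ω ∂μ)) / 2) := by
  have hsb : IsSelfBounding f := by
    rcases hf with hf | ⟨⟨h0, hs⟩ | hs, hm⟩
    · exact hf
    · exact isSelfBounding_of_sum_sub_erase_le hm (hs.sum_sub_erase_le h0)
    · exact isSelfBounding_of_sum_sub_erase_le hm hs.sum_sub_erase_le
  obtain rfl : Z = fun ω => f (fun i => X i ω) := funext hZ
  have hpr : ∀ i, IsProbabilityMeasure (μ.map (X i)) := fun i =>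
    Measure.isProbabilityMeasure_map (hX i).aemeasurable
  have hp1 : ∀ i, ∑ a, (μ.map (X i)).real {a} = 1 := fun i => by
    rw [sum_measureReal_singleton, Finset.coe_univ, probReal_univ]
  have hm0 : 0 ≤ ∫ ω, f (fun i => X i ω) ∂μ := integral_nonneg fun ω => hsb.nonneg _
  have hmgf : ∀ t, mgf (fun ω => f (fun i => X i ω)) μ t ≤
      Real.exp ((Real.exp t - 1) * ∫ ω, f (fun i => X i ω) ∂μ) := fun t => by
    rw [mgf, integral_comp_eq_weightedMean μ hX hindep f,
      integral_comp_eq_weightedMean μ hX hindep (fun x => Real.exp (t * f x))]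
    exact hsb.weightedMean_exp_le (fun i a => measureReal_nonneg) hp1 t
  have hint : ∀ t : ℝ, Integrable (fun ω => Real.exp (t * f (fun i => X i ω))) μ := fun t =>
    (Integrable.of_finite (μ := μ.map fun ω i => X i ω)
      (f := fun x => Real.exp (t * f x))).comp_measurable (measurable_pi_lambda _ hX)
  set m := ∫ ω, f (fun i => X i ω) ∂μ
  have h1 : 0 < 1 + δ := by linarith
  constructor
  · have h := (measure_ge_le_exp_mul_mgf ((1 + δ) * m)
      (Real.log_nonneg (by linarith : 1 ≤ 1 + δ)) (hint _)).trans
        (mul_le_mul_of_nonneg_left (hmgf _) (Real.exp_pos _).le)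
    refine h.trans (le_of_eq ?_)
    rw [Real.exp_log h1, ← Real.exp_add, Real.rpow_def_of_pos h1, ← Real.exp_sub,
      ← Real.exp_mul]
    congr 1
    ring
  · have h := (measure_le_le_exp_mul_mgf ((1 - δ) * m)
      (by linarith : -δ ≤ 0) (hint _)).trans
        (mul_le_mul_of_nonneg_left (hmgf _) (Real.exp_pos _).le)
    refine h.trans ?_
    rw [← Real.exp_add, Real.exp_le_exp]
    have h2 := mul_le_mul_of_nonneg_right (exp_neg_le_quadratic hδ.le) hm0
    linarith
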